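/- Let $k$ be an algebraically closed field, let $n\ge 3$, and let $\Gamma\subset\mathbb{P}^n_k$ be a set of $n+2$ distinct points in general linear position, i.e. no $n+1$ of them lie on a hyperplane. Let $R=k[x_0,\ldots,x_n]$, $\mathfrak{m}=(x_0,\ldots,x_n)$, and let $J=\bigcap_{p\in\Gamma}I(p)\subset R$ be the homogeneous ideal of $\Gamma$, where $I(p)$ is generated by the homogeneous polynomials vanishing at $p$. Let $f_1,\ldots,f_m$ be any finite system of homogeneous generators of $J$ (for instance a minimal one), let $\Theta=(\partial f_i/\partial x_j)$ be its Jacobian matrix, let $I_n(\Theta)$ be the ideal generated by the $n\times n$ minors of $\Theta$, and put $I=(J,I_n(\Theta))$. Then $$I_n(\Theta)=\mathfrak{m}^n,$$ and the pair $J\subset I$ is Aluffi torsion-free, i.e. its Valabrega--Valla module $\bigoplus_{t\ge 2}(J\cap I^t)/JI^{t-1}$ is zero; equivalently, $J\cap I^t=JI^{t-1}$ for all $t\ge 1$. -/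

import Mathlib

open MvPolynomial
open scoped LinearAlgebra.Projectivization DirectSum

/-- A finite set `Γ` of points of `ℙⁿ` is in general linear position if either `#Γ ≤ n` and the
points span a `ℙ^(#Γ - 1)` (the lines they represent span a subspace of dimension `#Γ`), or
`#Γ ≥ n + 1` and no `n + 1` of the points lie on a common hyperplane. -/
def InGeneralLinearPosition {k : Type*} [Field k] {n : ℕ}
    (Γ : Finset (ℙ k (Fin (n + 1) → k))) : Prop :=
  (Γ.card ≤ n ∧
    Module.finrank k (⨆ p ∈ Γ, p.submodule : Submodule k (Fin (n + 1) → k)) = Γ.card) ∨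
  (n + 1 ≤ Γ.card ∧
    ∀ S : Finset (ℙ k (Fin (n + 1) → k)), S ⊆ Γ → S.card = n + 1 →
      ¬ ∃ H : Submodule k (Fin (n + 1) → k),
        Module.finrank k H = n ∧ ∀ p ∈ S, p.submodule ≤ H)

/-- The homogeneous ideal `I(p)` of a point `p ∈ ℙⁿ`, generated by the homogeneous polynomials
vanishing at `p` (vanishing does not depend on the chosen representative). -/
noncomputable def pointIdeal {k : Type*} [Field k] {n : ℕ} (p : ℙ k (Fin (n + 1) → k)) :
    Ideal (MvPolynomial (Fin (n + 1)) k) :=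
  Ideal.span {f | (∃ d : ℕ, f.IsHomogeneous d) ∧ eval p.rep f = 0}

/-- The defining ideal `⋂ I(p)`, `p ∈ Γ`, of a finite set of points. -/
noncomputable def idealOfPoints {k : Type*} [Field k] {n : ℕ} (Γ : Finset (ℙ k (Fin (n + 1) → k))) :
    Ideal (MvPolynomial (Fin (n + 1)) k) :=
  ⨅ p ∈ Γ, pointIdeal p

/-- The irrelevant ideal `(x₀, …, xₙ)`. -/
noncomputable def irrelevantIdeal (k : Type*) [Field k] (n : ℕ) : Ideal (MvPolynomial (Fin (n + 1)) k) :=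
  Ideal.span (Set.range X)

/-- The Jacobian matrix `(∂fᵢ/∂xⱼ)`. -/
noncomputable def jacobianMatrix {k : Type*} [Field k] {m n : ℕ}
    (f : Fin m → MvPolynomial (Fin (n + 1)) k) :
    Matrix (Fin m) (Fin (n + 1)) (MvPolynomial (Fin (n + 1)) k) :=
  Matrix.of fun i j => pderiv j (f i)

/-- The ideal `I_r(M)` generated by the `r × r` minors of `M`. -/
def minorsIdeal {R : Type*} [CommRing R] {ι κ : Type*} (r : ℕ) (M : Matrix ι κ R) : Ideal R :=
  Ideal.span {d | ∃ (a : Fin r ↪ ι) (b : Fin r ↪ κ), d = (M.submatrix a b).det}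

/-- The Valabrega–Valla module `⨁_{t ≥ 2} (J ∩ I^t) / J I^(t-1)` of a pair of ideals `J ⊆ I`. -/
abbrev ValabregaVallaModule {R : Type*} [CommRing R] (J I : Ideal R) : Type _ :=
  ⨁ t : {t : ℕ // 2 ≤ t},
    (↥(J ⊓ I ^ (t : ℕ)) ⧸ Submodule.comap (J ⊓ I ^ (t : ℕ)).subtype (J * I ^ ((t : ℕ) - 1)))

/-- The pair `J ⊆ I` is Aluffi torsion-free if its Valabrega–Valla module vanishes. -/
def IsAluffiTorsionFree {R : Type*} [CommRing R] (J I : Ideal R) : Prop :=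
  J ≤ I ∧ Subsingleton (ValabregaVallaModule J I)

/-! General position allows a basis of k^(n+1) in which Γ consists of the coordinate points and the
unit point. In the dual linear forms y_i, the ideal J contains every y_a y_b - y_c y_d with a ≠ b
and c ≠ d, and it has no nonzero form of degree at most 1.

Minors: the nonzero generators have degree at least 2, so the entries of Θ lie in 𝔪 and I_n(Θ) ⊆
𝔪^n. Conversely, each quadric above is a scalar combination of the f_i, so by Cauchy–Binet its
Jacobian minors in the y-coordinates lie in I_n(Θ). These minors contain every monomial of degree n
in the y_i (`prod_mem_quadricMinors`), by induction from explicit cubics in four variables.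

Torsion-freeness: the quadrics generate J in the sense that J ∩ 𝔪^(e+2) ⊆ J𝔪^e
(`inf_pow_le_mul_pow`). With I = J + 𝔪^n, expanding I^t and applying the modular law leaves only J ∩
𝔪^(nt) ⊆ J𝔪^(nt-2) ⊆ JI^(t-1) to check (`inf_sup_pow_eq`). -/

/-! ### Ideals of minors under matrix products -/

section Minors

variable {R : Type*} [CommRing R]

/-- A weak form of the Cauchy–Binet formula. -/
theorem det_mul_mem_minorsIdeal {ι κ : Type*} [Fintype ι] (r : ℕ) (A : Matrix (Fin r) ι R)
    (M : Matrix ι κ R) (b : Fin r ↪ κ) :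
    (A * M.submatrix id b).det ∈ minorsIdeal r M := by
  classical
  have h : (A * M.submatrix id b).det =
      ∑ s : Fin r → ι, (∏ i, A i (s i)) * (M.submatrix s b).det := by
    have h1 : (A * M.submatrix id b) =
        fun i => ∑ l, A i l • (fun j => M l (b j)) := by
      ext i j
      simp [Matrix.mul_apply]
    have h2 := (Matrix.detRowAlternating (n := Fin r) (R := R)).toMultilinearMap.map_sum
      (fun (i : Fin r) (l : ι) => A i l • (fun j => M l (b j)))
    rw [h1]
    refine h2.trans (Finset.sum_congr rfl fun s _ => ?_)
    have h3 := (Matrix.detRowAlternating (n := Fin r) (R := R)).toMultilinearMap.map_smul_univ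
      (fun i => A i (s i)) (fun i j => M (s i) (b j))
    exact h3
  rw [h]
  refine Ideal.sum_mem _ fun s _ => Ideal.mul_mem_left _ _ ?_
  -- A non-injective choice of rows repeats a row, so only genuine minors survive.
  by_cases hs : Function.Injective s
  · exact Ideal.subset_span ⟨⟨s, hs⟩, b, rfl⟩
  · rw [Function.not_injective_iff] at hs
    obtain ⟨i, j, hij, hne⟩ := hs
    rw [Matrix.det_zero_of_row_eq hne (by ext l; simp [hij])]
    exact Ideal.zero_mem _

theorem det_mul_mul_mem_minorsIdeal {ι κ : Type*} [Fintype ι] [Fintype κ] (r : ℕ)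
    (A : Matrix (Fin r) ι R) (M : Matrix ι κ R) (B : Matrix κ (Fin r) R) :
    (A * M * B).det ∈ minorsIdeal r M := by
  have h := det_mul_mem_minorsIdeal r B.transpose (A * M).transpose (Function.Embedding.refl _)
  have e : B.transpose * (A * M).transpose.submatrix id (Function.Embedding.refl (Fin r)) =
      (A * M * B).transpose := by
    rw [Matrix.transpose_mul (A * M)]; rfl
  rw [e, Matrix.det_transpose] at h
  refine (Ideal.span_le.2 ?_ : minorsIdeal r (A * M).transpose ≤ minorsIdeal r M) h
  rintro _ ⟨a, b, rfl⟩
  have h' := det_mul_mem_minorsIdeal r (A.submatrix b id) M a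
  have e' : A.submatrix b id * M.submatrix id a = ((A * M).transpose.submatrix a b).transpose := by
    ext i j
    simp [Matrix.mul_apply, mul_comm]
  rwa [e', Matrix.det_transpose] at h'

theorem det_mem_pow {I : Ideal R} (r : ℕ) (M : Matrix (Fin r) (Fin r) R)
    (h : ∀ i j, M i j ∈ I) : M.det ∈ I ^ r := by
  rw [Matrix.det_apply]
  refine Ideal.sum_mem _ fun σ _ => ?_
  rw [Units.smul_def, zsmul_eq_mul]
  refine Ideal.mul_mem_left _ _ ?_
  have := Ideal.prod_mem_prod (s := Finset.univ) (I := fun _ : Fin r => I)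
    (x := fun i => M (σ i) i) fun i _ => h _ _
  simpa using this

end Minors

/-! ### Jacobian minors of the quadrics contain all monomials -/

section QuadricMinors

variable {k A ι : Type*} [CommRing k] [CommRing A] [Algebra k A]

/-- The differences of two square-free quadratic monomials in the `y i`, `i ∈ s`. -/
def quadricDifferences (y : ι → A) (s : Finset ι) : Set A :=
  {q | ∃ a ∈ s, ∃ b ∈ s, ∃ c ∈ s, ∃ d ∈ s, a ≠ b ∧ c ≠ d ∧ q = y a * y b - y c * y d}

/-- The ideal generated by the `r × r` Jacobian determinants, with respect to the derivations
`D i`, `i ∈ s`, of elements of `quadricDifferences y s`. -/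
def quadricMinors (D : ι → Derivation k A A) (y : ι → A) (s : Finset ι) (r : ℕ) : Ideal A :=
  Ideal.span {d | ∃ (g : Fin r → A) (b : Fin r → ι), (∀ i, g i ∈ quadricDifferences y s) ∧
    (∀ j, b j ∈ s) ∧ d = (Matrix.of fun i j => D (b j) (g i)).det}

theorem quadricDifferences_mono (y : ι → A) {s t : Finset ι} (h : s ⊆ t) :
    quadricDifferences y s ⊆ quadricDifferences y t := by
  rintro q ⟨a, ha, b, hb, c, hc, d, hd, H⟩
  exact ⟨a, h ha, b, h hb, c, h hc, d, h hd, H⟩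

variable {D : ι → Derivation k A A} {y : ι → A}

theorem derivation_quadricDifference [DecidableEq ι]
    (hD : ∀ i j, D j (y i) = if i = j then 1 else 0)
    (a b c d j : ι) : D j (y a * y b - y c * y d) =
      y a * (if b = j then 1 else 0) + y b * (if a = j then 1 else 0)
      - (y c * (if d = j then 1 else 0) + y d * (if c = j then 1 else 0)) := by
  simp only [map_sub, Derivation.leibniz, hD, smul_eq_mul]

theorem det_three_mem_quadricMinors {s : Finset ι} {g₀ g₁ g₂ : A} {b₀ b₁ b₂ : ι}
    (h₀ : g₀ ∈ quadricDifferences y s) (h₁ : g₁ ∈ quadricDifferences y s)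
    (h₂ : g₂ ∈ quadricDifferences y s) (hb₀ : b₀ ∈ s) (hb₁ : b₁ ∈ s) (hb₂ : b₂ ∈ s) :
    D b₀ g₀ * D b₁ g₁ * D b₂ g₂ - D b₀ g₀ * D b₂ g₁ * D b₁ g₂
      - D b₁ g₀ * D b₀ g₁ * D b₂ g₂ + D b₁ g₀ * D b₂ g₁ * D b₀ g₂
      + D b₂ g₀ * D b₀ g₁ * D b₁ g₂ - D b₂ g₀ * D b₁ g₁ * D b₀ g₂ ∈ quadricMinors D y s 3 := by
  refine Ideal.subset_span ⟨![g₀, g₁, g₂], ![b₀, b₁, b₂], ?_, ?_, ?_⟩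
  · intro i; fin_cases i <;> assumption
  · intro i; fin_cases i <;> assumption
  · rw [Matrix.det_fin_three]; rfl

set_option linter.unusedSimpArgs false in
/-- Three families of cubics obtained from Jacobian determinants of three quadrics, two of
which are divisible by `y o`. -/
theorem cubics_mem_quadricMinors [DecidableEq ι]
    (hD : ∀ i j, D j (y i) = if i = j then 1 else 0)
    {s : Finset ι} {o a b c : ι} (ho : o ∈ s) (ha : a ∈ s) (hb : b ∈ s) (hc : c ∈ s)
    (hoa : o ≠ a) (hob : o ≠ b) (hoc : o ≠ c) (hab : a ≠ b) (hac : a ≠ c) (hbc : b ≠ c) :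
    y o ^ 2 * (y o - y a - y b) ∈ quadricMinors D y s 3 ∧
    y o * (y c * (y a + y o - y c)) ∈ quadricMinors D y s 3 ∧
    y o * (2 * (y a * y b) + y c * (y o - y a - y b)) ∈ quadricMinors D y s 3 := by
  have q : ∀ {i j l m : ι}, i ∈ s → j ∈ s → l ∈ s → m ∈ s → i ≠ j → l ≠ m →
      y i * y j - y l * y m ∈ quadricDifferences y s :=
    fun hi hj hl hm h h' => ⟨_, hi, _, hj, _, hl, _, hm, h, h', rfl⟩
  refine ⟨?_, ?_, ?_⟩
  · have := det_three_mem_quadricMinors (D := D) (q ho ha ho hb hoa hob) (q ho hb ho hc hob hoc)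
      (q ho ha ha hb hoa hab) ha hb hc
    simp only [derivation_quadricDifference hD, hoa, hob, hoc, hab, hac, hbc, hoa.symm, hob.symm,
      hoc.symm, hab.symm, hac.symm, hbc.symm, if_true, if_false] at this
    convert this using 1; ring
  · have := det_three_mem_quadricMinors (D := D) (q ho ha ho hc hoa hoc) (q ho hb ho hc hob hoc)
      (q ho ha ha hc hoa hac) ho ha hb
    simp only [derivation_quadricDifference hD, hoa, hob, hoc, hab, hac, hbc, hoa.symm, hob.symm,
      hoc.symm, hab.symm, hac.symm, hbc.symm, if_true, if_false] at this
    convert this using 1; ring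
  · have := det_three_mem_quadricMinors (D := D) (q ho ha ho hc hoa hoc) (q ho hb ho hc hob hoc)
      (q ho ha ha hb hoa hab) ho ha hb
    simp only [derivation_quadricDifference hD, hoa, hob, hoc, hab, hac, hbc, hoa.symm, hob.symm,
      hoc.symm, hab.symm, hac.symm, hbc.symm, if_true, if_false] at this
    convert this using 1; ring

variable [DecidableEq ι]

theorem exists_two_others {s : Finset ι} (hs : s.card = 4) {p q : ι} (hp : p ∈ s) (hq : q ∈ s)
    (hpq : p ≠ q) : ∃ c ∈ s, ∃ d ∈ s, p ≠ c ∧ p ≠ d ∧ q ≠ c ∧ q ≠ d ∧ c ≠ d := by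
  have h : ((s.erase p).erase q).card = 2 := by
    rw [Finset.card_erase_of_mem (Finset.mem_erase.2 ⟨hpq.symm, hq⟩), Finset.card_erase_of_mem hp,
      hs]
  obtain ⟨c, d, hcd, h⟩ := Finset.card_eq_two.1 h
  have hc : c ∈ (s.erase p).erase q := by simp [h]
  have hd : d ∈ (s.erase p).erase q := by simp [h]
  simp only [Finset.mem_erase] at hc hd
  exact ⟨c, hc.2.2, d, hd.2.2, hc.2.1.symm, hd.2.1.symm, hc.1.symm, hd.1.symm, hcd⟩

/-- Differences within the second family of cubics give y_o y_a (y_b - y_c) and y_o y_b (y_a - y_c).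
Subtracting both from the third cubic cancels 2 y_o y_a y_b without dividing by 2, so characteristic
2 is included. -/
theorem sq_mul_mem_quadricMinors (hD : ∀ i j, D j (y i) = if i = j then 1 else 0)
    {s : Finset ι} (hs : s.card = 4) {o c : ι} (ho : o ∈ s) (hc : c ∈ s) (hoc : o ≠ c) :
    y o ^ 2 * y c ∈ quadricMinors D y s 3 := by
  obtain ⟨a, ha, b, hb, hoa, hob, hca, hcb, hab⟩ := exists_two_others hs ho hc hoc
  have h₁ := (cubics_mem_quadricMinors hD ho ha hb hc hoa hob hoc hab hca.symm hcb.symm).2.2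
  have h₂ := (cubics_mem_quadricMinors hD ho hb hc ha hob hoc hoa hcb.symm hab.symm hca).2.1
  have h₃ := (cubics_mem_quadricMinors hD ho hc hb ha hoc hob hoa hcb hca hab.symm).2.1
  have h₄ := (cubics_mem_quadricMinors hD ho ha hc hb hoa hoc hob hca.symm hab hcb).2.1
  have h₅ := (cubics_mem_quadricMinors hD ho hc ha hb hoc hoa hob hca hcb hab).2.1
  convert sub_mem (sub_mem h₁ (sub_mem h₂ h₃)) (sub_mem h₄ h₅) using 1
  ring

theorem cube_mem_quadricMinors (hD : ∀ i j, D j (y i) = if i = j then 1 else 0)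
    {s : Finset ι} (hs : s.card = 4) {o : ι} (ho : o ∈ s) :
    y o ^ 3 ∈ quadricMinors D y s 3 := by
  obtain ⟨a, ha, hao⟩ := Finset.exists_mem_ne (by omega : 1 < s.card) o
  obtain ⟨b, hb, c, hc, hob, hoc, hab, hac, hbc⟩ := exists_two_others hs ho ha hao.symm
  have h := (cubics_mem_quadricMinors hD ho ha hb hc hao.symm hob hoc hab hac hbc).1
  convert add_mem h (add_mem (sq_mul_mem_quadricMinors hD hs ho ha hao.symm)
    (sq_mul_mem_quadricMinors hD hs ho hb hob)) using 1
  ring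

theorem mul_mul_mem_quadricMinors (hD : ∀ i j, D j (y i) = if i = j then 1 else 0)
    {s : Finset ι} (hs : s.card = 4) {o a c : ι} (ho : o ∈ s) (ha : a ∈ s) (hc : c ∈ s) :
    y o * y a * y c ∈ quadricMinors D y s 3 := by
  by_cases hoa : o = a
  · subst hoa
    by_cases hoc : o = c
    · subst hoc
      convert cube_mem_quadricMinors hD hs ho using 1; ring
    · convert sq_mul_mem_quadricMinors hD hs ho hc hoc using 1; ring
  by_cases hoc : o = c
  · subst hoc
    convert sq_mul_mem_quadricMinors hD hs ho ha hoa using 1; ring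
  by_cases hac : a = c
  · subst hac
    convert sq_mul_mem_quadricMinors hD hs ha ho (Ne.symm hoa) using 1; ring
  obtain ⟨b, hb, hob, hab, hcb⟩ : ∃ b ∈ s, o ≠ b ∧ a ≠ b ∧ c ≠ b := by
    obtain ⟨b, hb, d, hd, hob, hod, hab, had, hbd⟩ := exists_two_others hs ho ha hoa
    by_cases hbc : c = b
    · exact ⟨d, hd, hod, had, fun h => hbd (hbc.symm.trans h)⟩
    · exact ⟨b, hb, hob, hab, hbc⟩
  have h := (cubics_mem_quadricMinors hD ho ha hb hc hoa hob hoc hab hac hcb.symm).2.1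
  convert add_mem (sub_mem h (sq_mul_mem_quadricMinors hD hs ho hc hoc))
    (sq_mul_mem_quadricMinors hD hs hc ho (Ne.symm hoc)) using 1
  ring

theorem mul_mem_quadricMinors_succ (hD : ∀ i j, D j (y i) = if i = j then 1 else 0)
    {s : Finset ι} {r : ℕ} {z a : ι} (hz : z ∉ s) (ha : a ∈ s) (hs : 1 < s.card)
    {x : A} (hx : x ∈ quadricMinors D y s r) :
    y a * x ∈ quadricMinors D y (insert z s) (r + 1) := by
  have hsub : s ⊆ insert z s := Finset.subset_insert z s
  obtain ⟨b, hb, c, hc, hbc⟩ := Finset.one_lt_card.1 hs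
  have hzs : ∀ {i}, i ∈ s → i ≠ z := fun hi h => hz (h ▸ hi)
  have hvan : ∀ g ∈ quadricDifferences y s, D z g = 0 := by
    rintro _ ⟨i, hi, j, hj, l, hl, m, hm, -, -, rfl⟩
    simp [derivation_quadricDifference hD, hzs hi, hzs hj, hzs hl, hzs hm]
  refine Submodule.span_induction (p := fun x _ => y a * x ∈ quadricMinors D y (insert z s) (r + 1))
    ?_ (by simp) (fun u v _ _ hu hv => by rw [mul_add]; exact add_mem hu hv)
    (fun w u _ hu => by rw [smul_eq_mul, mul_left_comm]; exact Ideal.mul_mem_left _ _ hu) hx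
  rintro _ ⟨g, e, hg, he, rfl⟩
  -- The other quadrics do not involve y_z, so the `D z` column is y_a followed by zeros, and the
  -- determinant is y_a times the old minor.
  refine Ideal.subset_span ⟨Fin.cons (y z * y a - y b * y c) g, Fin.cons z e, ?_, ?_, ?_⟩
  · refine Fin.cases ?_ fun i => ?_
    · exact ⟨z, Finset.mem_insert_self _ _, a, hsub ha, b, hsub hb, c, hsub hc, (hzs ha).symm, hbc,
        rfl⟩
    · exact quadricDifferences_mono y hsub (hg i)
  · exact Fin.cases (Finset.mem_insert_self _ _) fun i => hsub (he i)
  · rw [Matrix.det_succ_column_zero, Fin.sum_univ_succ, Finset.sum_eq_zero]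
    · simp only [Matrix.of_apply, Fin.cons_zero, derivation_quadricDifference hD, hzs ha, hzs hb,
        hzs hc]
      simp
      rfl
    · intro i _
      simp [hvan _ (hg i)]

/-- Every monomial of degree `r ≥ 3` in `r + 1` variables is in the ideal of Jacobian minors of
the differences of square-free quadratic monomials. -/
theorem prod_mem_quadricMinors (hD : ∀ i j, D j (y i) = if i = j then 1 else 0)
    {r : ℕ} (hr : 3 ≤ r) : ∀ {s : Finset ι}, s.card = r + 1 → ∀ {t : Fin r → ι},
    (∀ i, t i ∈ s) → ∏ i, y (t i) ∈ quadricMinors D y s r := by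
  induction r, hr using Nat.le_induction with
  | base =>
    intro s hs t ht
    rw [Fin.prod_univ_three]
    exact mul_mul_mem_quadricMinors hD hs (ht 0) (ht 1) (ht 2)
  | succ r hr ih =>
    intro s hs t ht
    -- A monomial with r + 1 factors misses one of the r + 2 variables.
    obtain ⟨z, hz, hzt⟩ : ∃ z ∈ s, z ∉ Finset.univ.image t := by
      by_contra! h
      have h1 := Finset.card_le_card (h : s ⊆ _)
      have h2 := Finset.card_image_le (s := Finset.univ) (f := t)
      simp only [Finset.card_univ, Fintype.card_fin] at h2
      omega
    have ht' : ∀ i, t i ∈ s.erase z := fun i =>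
      Finset.mem_erase.2 ⟨fun h => hzt (h ▸ Finset.mem_image_of_mem t (Finset.mem_univ i)), ht i⟩
    have hcard : (s.erase z).card = r + 1 := by rw [Finset.card_erase_of_mem hz]; omega
    rw [Fin.prod_univ_succ, ← Finset.insert_erase hz]
    exact mul_mem_quadricMinors_succ hD (Finset.notMem_erase _ _) (ht' 0) (by omega)
      (ih hcard fun i => ht' _)

end QuadricMinors

/-! ### Normal form of n + 2 points in general position -/

section Points

variable {k : Type*} [Field k] {n : ℕ}

theorem eval_smul_of_isHomogeneous {R σ : Type*} [CommRing R] [Fintype σ] {g : MvPolynomial σ R}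
    {d : ℕ} (hg : g.IsHomogeneous d) (c : R) (v : σ → R) :
    eval (c • v) g = c ^ d * eval v g := by
  rw [eval_eq', eval_eq', Finset.mul_sum]
  refine Finset.sum_congr rfl fun m hm => ?_
  have hd : ∑ i, m i = d := by
    rw [hg.degree_eq_sum_deg_support hm]
    exact (Finset.sum_subset (Finset.subset_univ _) (by simp)).symm
  simp only [Pi.smul_apply, smul_eq_mul, mul_pow, Finset.prod_mul_distrib,
    Finset.prod_pow_eq_pow_sum, hd]
  ring

theorem mem_idealOfPoints_iff (Γ : Finset (ℙ k (Fin (n + 1) → k)))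
    {g : MvPolynomial (Fin (n + 1)) k} {d : ℕ} (hg : g.IsHomogeneous d) :
    g ∈ idealOfPoints Γ ↔ ∀ p ∈ Γ, eval p.rep g = 0 := by
  simp only [idealOfPoints, Ideal.mem_iInf]
  refine forall₂_congr fun p _ => ⟨fun h => ?_, fun h => Ideal.subset_span ⟨⟨d, hg⟩, h⟩⟩
  have : pointIdeal p ≤ RingHom.ker (eval p.rep) :=
    Ideal.span_le.2 fun f hf => (RingHom.mem_ker).2 hf.2
  exact this h

theorem homogeneousComponent_mem_idealOfPoints (Γ : Finset (ℙ k (Fin (n + 1) → k)))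
    {g : MvPolynomial (Fin (n + 1)) k} (hg : g ∈ idealOfPoints Γ) (d : ℕ) :
    homogeneousComponent d g ∈ idealOfPoints Γ := by
  let _ := MvPolynomial.gradedAlgebra (σ := Fin (n + 1)) (R := k)
  exact homogeneousComponent_mem_of_mem (Ideal.IsHomogeneous.iInf₂ fun _ _ =>
    Ideal.homogeneous_span _ _ fun _ hf => hf.1) hg d

/-- Otherwise the kernel of φ would be a hyperplane through the n + 1 points other than p. -/
theorem dual_eq_zero_of_vanishing {Γ : Finset (ℙ k (Fin (n + 1) → k))} (hcard : Γ.card = n + 2)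
    (hΓ : InGeneralLinearPosition Γ) {p : ℙ k (Fin (n + 1) → k)} (hp : p ∈ Γ)
    (φ : Module.Dual k (Fin (n + 1) → k)) (h : ∀ q ∈ Γ, q ≠ p → φ q.rep = 0) : φ = 0 := by
  classical
  obtain ⟨h', -⟩ | ⟨-, hΓ⟩ := hΓ
  · omega
  by_contra hφ
  refine hΓ (Γ.erase p) (Finset.erase_subset _ _)
    (by rw [Finset.card_erase_of_mem hp, hcard]; rfl) ⟨LinearMap.ker φ, ?_, fun q hq => ?_⟩
  · have := Module.Dual.finrank_ker_add_one_of_ne_zero hφ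
    rw [Module.finrank_fin_fun] at this
    omega
  · rw [q.submodule_eq, Submodule.span_singleton_le_iff_mem]
    exact h q (Finset.mem_of_mem_erase hq) (Finset.ne_of_mem_erase hq)

/-- In a suitable basis, `n + 2` points of `ℙⁿ` in general linear position are the coordinate
points and the unit point. -/
theorem exists_basis_of_generalPosition {Γ : Finset (ℙ k (Fin (n + 1) → k))}
    (hcard : Γ.card = n + 2) (hΓ : InGeneralLinearPosition Γ) :
    ∃ b : Module.Basis (Fin (n + 1)) k (Fin (n + 1) → k),
      ∀ (d : ℕ) (g : MvPolynomial (Fin (n + 1)) k), g.IsHomogeneous d →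
        (g ∈ idealOfPoints Γ ↔ (∀ i, eval (b i) g = 0) ∧ eval (∑ i, b i) g = 0) := by
  classical
  let e : Fin (n + 2) ≃ Γ := (Γ.equivFinOfCardEq hcard).symm
  let w : Fin (n + 2) → Fin (n + 1) → k := fun i => (e i).1.rep
  have hw : ∀ (i : Fin (n + 2)) (φ : Module.Dual k (Fin (n + 1) → k)),
      (∀ j, j ≠ i → φ (w j) = 0) → φ = 0 := fun i φ h =>
    dual_eq_zero_of_vanishing hcard hΓ (e i).2 φ fun q hq hne => by
      have := h (e.symm ⟨q, hq⟩) (by rintro rfl; simp at hne)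
      simpa [w] using this
  have hspan : ⊤ ≤ Submodule.span k (Set.range fun i : Fin (n + 1) => w i.castSucc) := by
    by_contra hlt
    obtain ⟨φ, hφ, hle⟩ := Submodule.exists_le_ker_of_lt_top _
      (lt_of_le_of_ne le_top fun h => hlt h.ge)
    refine hφ (hw (Fin.last _) φ fun j hj => ?_)
    obtain ⟨i, rfl⟩ := Fin.exists_castSucc_eq.2 hj
    exact hle (Submodule.subset_span ⟨i, rfl⟩)
  let B := basisOfTopLeSpanOfCardEqFinrank _ hspan (by simp)
  have hB : ∀ i, B i = w i.castSucc := fun i => by simp [B]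
  -- If the i-th coordinate of the last point were zero, `B.coord i` would vanish at all points but
  -- the i-th.
  have hc : ∀ i, B.repr (w (Fin.last _)) i ≠ 0 := fun i h0 => by
    have h := hw i.castSucc (B.coord i) fun j hj => by
      rcases Fin.eq_castSucc_or_eq_last j with ⟨l, rfl⟩ | rfl
      · rw [← hB, Module.Basis.coord_apply, Module.Basis.repr_self, Finsupp.single_eq_of_ne]
        rintro rfl; exact hj rfl
      · exact h0
    have := congrArg (fun φ => φ (B i)) h
    simp at this
  -- Scaling each basis vector by that coordinate makes the last point the sum of the basis;
  -- vanishing of forms is unaffected.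
  refine ⟨B.unitsSMul fun i => Units.mk0 _ (hc i), fun d g hg => ?_⟩
  have hsum : ∑ i, (B.unitsSMul fun i => Units.mk0 _ (hc i)) i = w (Fin.last _) := by
    conv_rhs => rw [← B.sum_repr (w (Fin.last _))]
    exact Finset.sum_congr rfl fun i _ => by rw [Module.Basis.unitsSMul_apply]; rfl
  rw [mem_idealOfPoints_iff Γ hg, hsum]
  have h1 : (∀ p ∈ Γ, eval p.rep g = 0) ↔ ∀ i, eval (w i) g = 0 :=
    ⟨fun h i => h _ (e i).2, fun h p hp => by simpa [w] using h (e.symm ⟨p, hp⟩)⟩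
  rw [h1, Fin.forall_fin_succ']
  refine and_congr (forall_congr' fun i => ?_) Iff.rfl
  rw [Module.Basis.unitsSMul_apply, Units.smul_def, eval_smul_of_isHomogeneous hg, hB, mul_eq_zero,
    or_iff_right (pow_ne_zero _ (Units.ne_zero _))]

end Points

/-! ### Linear change of coordinates -/

section Coordinates

variable {k : Type*} [Field k] {n : ℕ} (b : Module.Basis (Fin (n + 1)) k (Fin (n + 1) → k))

/-- The linear forms dual to a basis of `k^(n+1)`. -/
noncomputable def dualForm (i : Fin (n + 1)) : MvPolynomial (Fin (n + 1)) k :=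
  ∑ j, C (b.repr (Pi.single j 1) i) * X j

/-- The derivative in the direction of a basis vector. -/
noncomputable def dirDeriv (i : Fin (n + 1)) :
    Derivation k (MvPolynomial (Fin (n + 1)) k) (MvPolynomial (Fin (n + 1)) k) :=
  ∑ j, b i j • pderiv j

theorem dualForm_isHomogeneous (i : Fin (n + 1)) : (dualForm b i).IsHomogeneous 1 :=
  IsHomogeneous.sum _ _ _ fun _ _ => isHomogeneous_C_mul_X _ _

theorem repr_eq_sum (v : Fin (n + 1) → k) (i : Fin (n + 1)) :
    b.repr v i = ∑ j, b.repr (Pi.single j 1) i * v j := by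
  conv_lhs => rw [← (Pi.basisFun k (Fin (n + 1))).sum_repr v]
  simp [mul_comm, Finsupp.finsetSum_apply]

theorem eval_dualForm (v : Fin (n + 1) → k) (i : Fin (n + 1)) :
    eval v (dualForm b i) = b.repr v i := by
  simp [dualForm, repr_eq_sum b v i]

theorem dirDeriv_apply (i : Fin (n + 1)) (g : MvPolynomial (Fin (n + 1)) k) :
    dirDeriv b i g = ∑ j, C (b i j) * pderiv j g := by
  rw [dirDeriv, ← Derivation.coeFnAddMonoidHom_apply, map_sum]
  simp [C_mul']

/-- Supplies the hypothesis `hD` of the results on `quadricMinors`. -/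
theorem dirDeriv_dualForm (i j : Fin (n + 1)) :
    dirDeriv b j (dualForm b i) = if i = j then 1 else 0 := by
  have h : ∀ l, pderiv l (dualForm b i) = C (b.repr (Pi.single l 1) i) := fun l => by
    simp [dualForm, pderiv_X, Pi.single_apply]
  simp only [dirDeriv_apply, h, ← C_mul, ← map_sum]
  have := repr_eq_sum b (b j) i
  simp only [mul_comm] at this
  rw [← this, b.repr_self, Finsupp.single_apply]
  by_cases hij : i = j <;> simp [hij, eq_comm]

theorem X_eq_sum_dualForm (j : Fin (n + 1)) :
    (X j : MvPolynomial (Fin (n + 1)) k) = ∑ i, C (b i j) * dualForm b i := by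
  have h : ∀ l, ∑ i, b i j * b.repr (Pi.single l 1) i = if l = j then 1 else 0 := fun l => by
    have := congrFun (b.sum_repr (Pi.single l (1 : k))) j
    simpa [Pi.single_apply, mul_comm, eq_comm] using this
  simp only [dualForm, Finset.mul_sum, ← mul_assoc, ← C_mul]
  rw [Finset.sum_comm]
  simp only [← Finset.sum_mul, ← map_sum, h]
  simp

theorem irrelevantIdeal_eq_span_dualForm :
    irrelevantIdeal k n = Ideal.span (Set.range (dualForm b)) := by
  refine le_antisymm (Ideal.span_le.2 ?_) (Ideal.span_le.2 ?_)
  · rintro _ ⟨j, rfl⟩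
    rw [X_eq_sum_dualForm b j]
    exact Ideal.sum_mem _ fun i _ => Ideal.mul_mem_left _ _ (Ideal.subset_span ⟨i, rfl⟩)
  · rintro _ ⟨i, rfl⟩
    exact Ideal.sum_mem _ fun j _ => Ideal.mul_mem_left _ _ (Ideal.subset_span ⟨j, rfl⟩)

/-- Every form is a form of the same degree in the linear forms `dualForm b i`. -/
theorem exists_aeval_dualForm_eq {d : ℕ} {g : MvPolynomial (Fin (n + 1)) k}
    (hg : g.IsHomogeneous d) : ∃ G : MvPolynomial (Fin (n + 1)) k, G.IsHomogeneous d ∧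
      aeval (dualForm b) G = g ∧ ∀ v, eval v g = eval (b.repr v) G := by
  have h : aeval (dualForm b) (aeval (fun j => ∑ i, C (b i j) * X i) g) = g := by
    rw [← AlgHom.comp_apply]
    convert AlgHom.id_apply (R := k) g
    ext j : 1
    simp only [AlgHom.comp_apply, aeval_X, map_sum, map_mul, AlgHom.id_apply, algHom_C]
    exact (X_eq_sum_dualForm b j).symm
  refine ⟨aeval (fun j => ∑ i, C (b i j) * X i) g, ?_, h, fun v => ?_⟩
  · simpa using hg.aeval (n := 1) (fun j => ∑ i, C (b i j) * X i)
      fun j => IsHomogeneous.sum _ _ _ fun _ _ => isHomogeneous_C_mul_X _ _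
  · conv_lhs => rw [← h]
    rw [← coe_aeval_eq_eval, ← coe_aeval_eq_eval]
    simp only [RingHom.coe_coe]
    rw [← AlgHom.comp_apply]
    congr 1
    ext i : 1
    simp [eval_dualForm]

end Coordinates

/-! ### Generation by quadrics -/

section QuadricGeneration

/-- Any other monomial of degree d involves a second variable, hence vanishes at the i-th coordinate
point. -/
theorem eval_single_eq_coeff {R σ : Type*} [CommRing R] [Fintype σ] [DecidableEq σ]
    {G : MvPolynomial σ R} {d : ℕ} (hG : G.IsHomogeneous d) (i : σ) :
    eval (Pi.single i 1) G = coeff (Finsupp.single i d) G := by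
  rw [eval_eq', Finset.sum_eq_single (Finsupp.single i d)]
  · rw [Finset.prod_eq_one, mul_one]
    intro j _
    by_cases h : j = i
    · subst h; simp
    · simp [Finsupp.single_eq_of_ne h]
  · intro m hm hne
    obtain ⟨j, hj, hmj⟩ : ∃ j, j ≠ i ∧ m j ≠ 0 := by
      by_contra! h
      have hm' : m = Finsupp.single i (m i) := by
        ext j
        by_cases hj : j = i
        · subst hj; simp
        · rw [h j hj, Finsupp.single_eq_of_ne hj]
      have hd : m.degree = d := by
        by_contra hd
        exact (mem_support_iff.1 hm) (hG.coeff_eq_zero hd)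
      rw [hm', Finsupp.degree_single] at hd
      exact hne (hd ▸ hm')
    rw [Finset.prod_eq_zero (Finset.mem_univ j), mul_zero]
    simp [hj, hmj]
  · intro h
    rw [notMem_support_iff.1 h, zero_mul]

variable {A ι : Type*} [CommRing A] {y : ι → A} {Q M : Ideal A}

/-- Modulo the differences of square-free quadratic monomials, all monomials of a given degree
involving at least two variables agree. -/
theorem monomial_sub_mem (hQ : ∀ a b c d, a ≠ b → c ≠ d → y a * y b - y c * y d ∈ Q)
    (hM : ∀ i, y i ∈ M) {o p q : ι} (hop : o ≠ p) (hoq : o ≠ q) (hpq : p ≠ q)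
    {i j : ι} (hij : i ≠ j) (m : Multiset ι) :
    y i * y j * (m.map y).prod - y o * y p * y p ^ m.card ∈ Q * M ^ m.card := by
  induction m using Multiset.induction_on with
  | empty => simpa using hQ i j o p hij hop
  | cons a m ih =>
    have hp : y p ^ m.card ∈ M ^ m.card := Ideal.pow_mem_pow (hM p) _
    have key : ∀ {u x : A}, u ∈ Q → x ∈ M → u * (x * y p ^ m.card) ∈ Q * M ^ (m.card + 1) :=
      fun hu hx => Ideal.mul_mem_mul hu (by rw [pow_succ']; exact Ideal.mul_mem_mul hx hp)
    have h1 : y a * (y i * y j * (m.map y).prod - y o * y p * y p ^ m.card) ∈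
        Q * M ^ (m.card + 1) := by
      rw [pow_succ, ← mul_assoc, mul_comm (y a)]
      exact Ideal.mul_mem_mul ih (hM a)
    rw [Multiset.map_cons, Multiset.prod_cons, Multiset.card_cons]
    -- For a ≠ o, trade y_a y_o for y_o y_p. For a = o that product is a square, so pass through the
    -- third index: y_o y_p becomes y_p y_q, then y_o y_q becomes y_o y_p.
    by_cases ha : a = o
    · subst ha
      have h2 := key (hQ a p p q hop hpq) (hM a)
      have h3 := key (hQ a q a p hoq hop) (hM p)
      convert add_mem h1 (add_mem h2 h3) using 1
      ring
    · have h2 := key (hQ a o o p ha hop) (hM p)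
      convert add_mem h1 h2 using 1
      ring

/-- Vanishing at the coordinate points excludes pure powers, so all monomials of G agree with y_o
y_p^(e+1) modulo Q M^e. Vanishing at the unit point makes the coefficients sum to zero. -/
theorem aeval_mem_mul_pow {k : Type*} [CommRing k] [Algebra k A] [Fintype ι] [DecidableEq ι]
    (hQ : ∀ a b c d, a ≠ b → c ≠ d → y a * y b - y c * y d ∈ Q)
    (hM : ∀ i, y i ∈ M) {o p q : ι} (hop : o ≠ p) (hoq : o ≠ q) (hpq : p ≠ q) {e : ℕ}
    {G : MvPolynomial ι k} (hG : G.IsHomogeneous (e + 2)) (h : ∀ i, eval (Pi.single i 1) G = 0)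
    (h1 : eval 1 G = 0) : aeval y G ∈ Q * M ^ e := by
  have hsum : ∑ m ∈ G.support, coeff m G = 0 := by
    rw [eval_eq'] at h1
    simpa using h1
  have hG' : aeval y G = ∑ m ∈ G.support, algebraMap k A (coeff m G) *
      ((m.prod fun i r => y i ^ r) - y o * y p * y p ^ e) := by
    simp only [mul_sub, Finset.sum_sub_distrib]
    rw [← Finset.sum_mul, ← map_sum, hsum, map_zero, zero_mul, sub_zero]
    conv_lhs => rw [G.as_sum, map_sum]
    simp only [aeval_monomial]
  rw [hG']
  refine Ideal.sum_mem _ fun m hm => Ideal.mul_mem_left _ _ ?_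
  have hdeg : m.degree = e + 2 := by
    by_contra hd
    exact (mem_support_iff.1 hm) (hG.coeff_eq_zero hd)
  obtain ⟨i, hi⟩ : ∃ i, m i ≠ 0 := by
    by_contra! h0
    have : m = 0 := Finsupp.ext h0
    simp [this] at hdeg
  obtain ⟨j, hji, hj⟩ : ∃ j, j ≠ i ∧ m j ≠ 0 := by
    by_contra! h0
    have hm' : m = Finsupp.single i (m i) := by
      ext j
      by_cases hj : j = i
      · subst hj; simp
      · rw [h0 j hj, Finsupp.single_eq_of_ne hj]
    have hmi : m i = e + 2 := by rwa [hm', Finsupp.degree_single] at hdeg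
    rw [hmi] at hm'
    refine (mem_support_iff.1 hm) ?_
    rw [hm', ← eval_single_eq_coeff hG, h]
  obtain ⟨m', rfl⟩ : ∃ m', m = Finsupp.single i 1 + (Finsupp.single j 1 + m') := by
    refine ⟨m - Finsupp.single i 1 - Finsupp.single j 1, ?_⟩
    ext l
    simp only [Finsupp.add_apply, Finsupp.tsub_apply, Finsupp.single_apply]
    split_ifs with h2 h3 h3
    · exact absurd (h3.trans h2.symm) hji
    · subst h2; omega
    · subst h3; omega
    · omega
  have hcard : m'.toMultiset.card = e := by
    simp only [map_add, Finsupp.degree_single] at hdeg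
    rw [Finsupp.card_toMultiset]
    have : (m'.sum fun _ => id) = m'.degree := rfl
    omega
  have hprod : ((Finsupp.single i 1 + (Finsupp.single j 1 + m')).prod fun i r => y i ^ r) =
      y i * y j * (m'.toMultiset.map y).prod := by
    rw [Finsupp.prod_add_index' (by simp) (by intros; rw [pow_add]),
      Finsupp.prod_add_index' (by simp) (by intros; rw [pow_add]), Finsupp.toMultiset_map,
      Finsupp.prod_toMultiset, Finsupp.prod_mapDomain_index (by simp) (by intros; rw [pow_add])]
    simp [mul_assoc]
  have := monomial_sub_mem hQ hM hop hoq hpq hji.symm m'.toMultiset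
  rwa [hcard, ← hprod] at this

end QuadricGeneration

/-! ### Graded structure of the ideal of the points -/

section Ideal

variable {k : Type*} [Field k] {n : ℕ} {Γ : Finset (ℙ k (Fin (n + 1) → k))}
  {b : Module.Basis (Fin (n + 1)) k (Fin (n + 1) → k)}

theorem dualForm_quadric_isHomogeneous (i j l m : Fin (n + 1)) :
    (dualForm b i * dualForm b j - dualForm b l * dualForm b m).IsHomogeneous 2 :=
  ((dualForm_isHomogeneous b i).mul (dualForm_isHomogeneous b j)).sub
    ((dualForm_isHomogeneous b l).mul (dualForm_isHomogeneous b m))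

theorem dualForm_quadric_mem
    (hb : ∀ (d : ℕ) (g : MvPolynomial (Fin (n + 1)) k), g.IsHomogeneous d →
      (g ∈ idealOfPoints Γ ↔ (∀ i, eval (b i) g = 0) ∧ eval (∑ i, b i) g = 0))
    (i j l m : Fin (n + 1)) (hij : i ≠ j) (hlm : l ≠ m) :
    dualForm b i * dualForm b j - dualForm b l * dualForm b m ∈ idealOfPoints Γ := by
  rw [hb 2 _ (dualForm_quadric_isHomogeneous i j l m)]
  have hp : ∀ {u v w : Fin (n + 1)}, u ≠ v →
      (Finsupp.single w (1 : k)) u * (Finsupp.single w (1 : k)) v = 0 := fun {u v w} h => by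
    by_cases hu : u = w
    · rw [Finsupp.single_eq_of_ne (a := w) (fun hv : v = w => h (hu.trans hv.symm)), mul_zero]
    · rw [Finsupp.single_eq_of_ne hu, zero_mul]
  refine ⟨fun w => ?_, ?_⟩
  · simp only [map_sub, map_mul, eval_dualForm, Module.Basis.repr_self, hp hij, hp hlm, sub_zero]
  · simp [eval_dualForm, Finsupp.finsetSum_apply, Finsupp.single_apply]

/-- In degree at most 1 every monomial is a pure power, whose coefficient is the value at a basis
vector. -/
theorem eq_zero_of_mem_of_degree_le_one
    (hb : ∀ (d : ℕ) (g : MvPolynomial (Fin (n + 1)) k), g.IsHomogeneous d →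
      (g ∈ idealOfPoints Γ ↔ (∀ i, eval (b i) g = 0) ∧ eval (∑ i, b i) g = 0))
    {d : ℕ} (hd : d ≤ 1) {g : MvPolynomial (Fin (n + 1)) k} (hg : g.IsHomogeneous d)
    (hJ : g ∈ idealOfPoints Γ) : g = 0 := by
  obtain ⟨G, hG, rfl, hev⟩ := exists_aeval_dualForm_eq b hg
  have hG0 : G = 0 := by
    ext m
    rw [coeff_zero]
    by_cases hm : m.degree = d
    · obtain ⟨i, rfl⟩ : ∃ i, m = Finsupp.single i d := by
        by_cases hm0 : m = 0
        · exact ⟨0, by simp [← hm, hm0]⟩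
        · obtain ⟨i, hi⟩ := Finsupp.ne_iff.1 hm0
          obtain ⟨m', rfl⟩ : ∃ m', m = Finsupp.single i 1 + m' :=
            le_iff_exists_add.1 (Finsupp.single_le_iff.2 (Nat.one_le_iff_ne_zero.2 hi))
          rw [map_add, Finsupp.degree_single] at hm
          have hm' : m' = 0 := (Finsupp.degree_eq_zero_iff _).1 (by omega)
          exact ⟨i, by rw [hm', map_zero] at hm; rw [hm', add_zero, ← hm, add_zero]⟩
      rw [← eval_single_eq_coeff hG, ← Finsupp.single_eq_pi_single, ← b.repr_self, ← hev]
      exact ((hb d _ hg).1 hJ).1 i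
    · exact hG.coeff_eq_zero hm
  simp [hG0]

theorem mem_mul_pow_of_isHomogeneous (hn : 3 ≤ n)
    (hb : ∀ (d : ℕ) (g : MvPolynomial (Fin (n + 1)) k), g.IsHomogeneous d →
      (g ∈ idealOfPoints Γ ↔ (∀ i, eval (b i) g = 0) ∧ eval (∑ i, b i) g = 0))
    {e : ℕ} {g : MvPolynomial (Fin (n + 1)) k} (hg : g.IsHomogeneous (e + 2))
    (hJ : g ∈ idealOfPoints Γ) : g ∈ idealOfPoints Γ * irrelevantIdeal k n ^ e := by
  obtain ⟨G, hG, rfl, hev⟩ := exists_aeval_dualForm_eq b hg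
  obtain ⟨h1, h2⟩ := (hb _ _ hg).1 hJ
  refine aeval_mem_mul_pow (dualForm_quadric_mem hb) (fun i => ?_) (o := ⟨0, by omega⟩)
    (p := ⟨1, by omega⟩) (q := ⟨2, by omega⟩) (by simp) (by simp) (by simp) hG (fun i => ?_) ?_
  · rw [irrelevantIdeal_eq_span_dualForm b]
    exact Ideal.subset_span ⟨i, rfl⟩
  · rw [← Finsupp.single_eq_pi_single, ← b.repr_self, ← hev]
    exact h1 i
  · rw [hev] at h2
    have hone : (1 : Fin (n + 1) → k) = b.repr (∑ i, b i) := by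
      funext i
      simp [Finsupp.finsetSum_apply, Finsupp.single_apply]
    rwa [hone]

theorem homogeneousComponent_eq_zero_of_mem_pow {g : MvPolynomial (Fin (n + 1)) k} {d e : ℕ}
    (hg : g ∈ irrelevantIdeal k n ^ e) (hd : d < e) : homogeneousComponent d g = 0 := by
  ext m
  rw [coeff_homogeneousComponent, coeff_zero]
  split_ifs with h
  · exact (mem_pow_idealOfVars_iff' _ _).1 hg m (by omega)
  · rfl

theorem mem_pow_of_isHomogeneous {g : MvPolynomial (Fin (n + 1)) k} {d : ℕ}
    (hg : g.IsHomogeneous d) : g ∈ irrelevantIdeal k n ^ d :=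
  (mem_pow_idealOfVars_iff' _ _).2 fun _ hm => hg.coeff_eq_zero hm.ne

theorem inf_pow_le_mul_pow (hn : 3 ≤ n)
    (hb : ∀ (d : ℕ) (g : MvPolynomial (Fin (n + 1)) k), g.IsHomogeneous d →
      (g ∈ idealOfPoints Γ ↔ (∀ i, eval (b i) g = 0) ∧ eval (∑ i, b i) g = 0)) (e : ℕ) :
    idealOfPoints Γ ⊓ irrelevantIdeal k n ^ (e + 2) ≤
      idealOfPoints Γ * irrelevantIdeal k n ^ e := by
  rintro g ⟨hJ, hm⟩
  rw [← sum_homogeneousComponent g]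
  refine Ideal.sum_mem _ fun d _ => ?_
  by_cases hd : e + 2 ≤ d
  · have h := mem_mul_pow_of_isHomogeneous hn hb (e := d - 2)
      (by rw [Nat.sub_add_cancel (by omega)]; exact homogeneousComponent_isHomogeneous d g)
      (homogeneousComponent_mem_idealOfPoints Γ hJ d)
    exact Ideal.mul_mono_right (Ideal.pow_le_pow_right (by omega)) h
  · rw [homogeneousComponent_eq_zero_of_mem_pow hm (by omega)]
    exact Ideal.zero_mem _

end Ideal

/-! ### Intersections of J with powers of J + M^n -/

section AluffiTorsionFree

theorem sup_pow_succ_le {R : Type*} [CommRing R] (J N : Ideal R) (s : ℕ) :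
    (J ⊔ N) ^ (s + 1) ≤ J * (J ⊔ N) ^ s ⊔ N ^ (s + 1) := by
  induction s with
  | zero => simp
  | succ s ih =>
    calc (J ⊔ N) ^ (s + 1 + 1) = (J ⊔ N) ^ (s + 1) * (J ⊔ N) := pow_succ _ _
      _ ≤ (J * (J ⊔ N) ^ s ⊔ N ^ (s + 1)) * (J ⊔ N) := Ideal.mul_mono_left ih
      _ = J * (J ⊔ N) ^ (s + 1) ⊔ (J * N ^ (s + 1) ⊔ N ^ (s + 1 + 1)) := by
        rw [Ideal.sup_mul, mul_assoc, ← pow_succ, Ideal.mul_sup, ← pow_succ, mul_comm _ J]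
      _ ≤ J * (J ⊔ N) ^ (s + 1) ⊔ N ^ (s + 1 + 1) :=
        sup_le le_sup_left (sup_le (le_sup_of_le_left
          (Ideal.mul_mono_right (Ideal.pow_right_mono le_sup_right _))) le_sup_right)

theorem inf_sup_pow_eq {R : Type*} [CommRing R] {J M : Ideal R}
    (hJM : ∀ e, J ⊓ M ^ (e + 2) ≤ J * M ^ e) {n : ℕ} (hn : 2 ≤ n) {t : ℕ} (ht : 1 ≤ t) :
    J ⊓ (J ⊔ M ^ n) ^ t = J * (J ⊔ M ^ n) ^ (t - 1) := by
  obtain ⟨s, rfl⟩ := Nat.exists_eq_add_of_le' ht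
  rw [Nat.add_sub_cancel]
  refine le_antisymm ?_ (le_inf Ideal.mul_le_left ?_)
  · calc J ⊓ (J ⊔ M ^ n) ^ (s + 1)
        ≤ (J * (J ⊔ M ^ n) ^ s ⊔ (M ^ n) ^ (s + 1)) ⊓ J := by
          rw [inf_comm]
          exact inf_le_inf_right _ (sup_pow_succ_le J (M ^ n) s)
      _ = J * (J ⊔ M ^ n) ^ s ⊔ (M ^ n) ^ (s + 1) ⊓ J := sup_inf_assoc_of_le _ Ideal.mul_le_left
      _ ≤ J * (J ⊔ M ^ n) ^ s := sup_le le_rfl ?_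
    obtain ⟨r, rfl⟩ := Nat.exists_eq_add_of_le' hn
    -- With n = r + 2, giving up two degrees of M^(n(s+1)) still leaves at least ns.
    rw [inf_comm, ← pow_mul, show (r + 2) * (s + 1) = (r + (r + 2) * s) + 2 by ring]
    refine (hJM _).trans (Ideal.mul_mono_right ?_)
    calc M ^ (r + (r + 2) * s) ≤ M ^ ((r + 2) * s) := Ideal.pow_le_pow_right (by omega)
      _ = (M ^ (r + 2)) ^ s := pow_mul _ _ _
      _ ≤ _ := Ideal.pow_right_mono le_sup_right _
  · rw [pow_succ']
    exact Ideal.mul_mono_left le_sup_left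

theorem isAluffiTorsionFree_of_inf_pow_eq {R : Type*} [CommRing R] {J I : Ideal R} (hJI : J ≤ I)
    (h : ∀ t : ℕ, 1 ≤ t → J ⊓ I ^ t = J * I ^ (t - 1)) : IsAluffiTorsionFree J I := by
  refine ⟨hJI, ?_⟩
  have : ∀ t : {t : ℕ // 2 ≤ t}, Subsingleton (↥(J ⊓ I ^ (t : ℕ)) ⧸
      Submodule.comap (J ⊓ I ^ (t : ℕ)).subtype (J * I ^ ((t : ℕ) - 1))) := fun t => by
    rw [Submodule.Quotient.subsingleton_iff, Submodule.comap_subtype_eq_top]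
    exact (h t (one_le_two.trans t.2)).le
  exact DFunLike.coe_injective.subsingleton

end AluffiTorsionFree

/-! ### Comparison of the Jacobian ideal with the power of 𝔪 -/

section Jacobian

variable {k : Type*} [Field k] {n : ℕ} {Γ : Finset (ℙ k (Fin (n + 1) → k))}
  {b : Module.Basis (Fin (n + 1)) k (Fin (n + 1) → k)} {m : ℕ}
  {f : Fin m → MvPolynomial (Fin (n + 1)) k}

theorem eq_zero_or_two_le_degree
    (hb : ∀ (d : ℕ) (g : MvPolynomial (Fin (n + 1)) k), g.IsHomogeneous d →
      (g ∈ idealOfPoints Γ ↔ (∀ i, eval (b i) g = 0) ∧ eval (∑ i, b i) g = 0))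
    (hf : ∀ i, ∃ d : ℕ, (f i).IsHomogeneous d)
    (hgen : Ideal.span (Set.range f) = idealOfPoints Γ) (i : Fin m) :
    f i = 0 ∨ ∃ d, 2 ≤ d ∧ (f i).IsHomogeneous d := by
  obtain ⟨d, hd⟩ := hf i
  by_cases h : d ≤ 1
  · exact Or.inl (eq_zero_of_mem_of_degree_le_one hb h hd (hgen ▸ Ideal.subset_span ⟨i, rfl⟩))
  · exact Or.inr ⟨d, by omega, hd⟩

/-- A quadric in the ideal generated by forms of degree at least two is a linear combination of
them. -/
theorem exists_linear_combination (hf : ∀ i, f i = 0 ∨ ∃ d, 2 ≤ d ∧ (f i).IsHomogeneous d)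
    {q : MvPolynomial (Fin (n + 1)) k} (hq : q.IsHomogeneous 2)
    (hmem : q ∈ Ideal.span (Set.range f)) : ∃ c : Fin m → k, q = ∑ l, C (c l) * f l := by
  obtain ⟨a, rfl⟩ := (Ideal.mem_span_range_iff_exists_fun).1 hmem
  have key : ∀ l, ∃ c : k, homogeneousComponent 2 (a l * f l) = C c * f l := fun l => by
    obtain h | ⟨d, hd, hfl⟩ := hf l
    · exact ⟨0, by simp [h]⟩
    -- Off its constant term, a_l contributes to a_l f_l only in degree at least 1 + d ≥ 3.
    have ha : a l - C (coeff 0 (a l)) ∈ irrelevantIdeal k n ^ 1 :=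
      (mem_pow_idealOfVars_iff' _ _).2 fun x hx => by
        have : x = 0 := (Finsupp.degree_eq_zero_iff _).1 (by omega)
        simp [this]
    have h0 : homogeneousComponent 2 ((a l - C (coeff 0 (a l))) * f l) = 0 :=
      homogeneousComponent_eq_zero_of_mem_pow (e := 1 + d)
        (by rw [pow_add]; exact Ideal.mul_mem_mul ha (mem_pow_of_isHomogeneous hfl)) (by omega)
    rw [sub_mul, map_sub, sub_eq_zero, homogeneousComponent_C_mul,
      homogeneousComponent_of_mem hfl] at h0
    rw [h0]
    split_ifs
    · exact ⟨_, rfl⟩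
    · exact ⟨0, by simp⟩
  choose c hc using key
  refine ⟨c, ?_⟩
  rw [← homogeneousComponent_eq_self hq, map_sum]
  exact Finset.sum_congr rfl fun l _ => hc l

/-- The directional Jacobian matrix of the quadrics is Θ multiplied on both sides by matrices of
constants. -/
theorem quadricMinors_le_minorsIdeal (b : Module.Basis (Fin (n + 1)) k (Fin (n + 1) → k)) (r : ℕ)
    (h : ∀ q ∈ quadricDifferences (dualForm b) Finset.univ, ∃ c : Fin m → k,
      q = ∑ l, C (c l) * f l) :
    quadricMinors (dirDeriv b) (dualForm b) Finset.univ r ≤ minorsIdeal r (jacobianMatrix f) := by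
  refine Ideal.span_le.2 ?_
  rintro _ ⟨g, e, hg, -, rfl⟩
  choose c hc using fun i => h (g i) (hg i)
  let L : Matrix (Fin r) (Fin m) (MvPolynomial (Fin (n + 1)) k) := Matrix.of fun i l => C (c i l)
  let B : Matrix (Fin (n + 1)) (Fin r) (MvPolynomial (Fin (n + 1)) k) :=
    Matrix.of fun p j => C (b (e j) p)
  have hmat : (Matrix.of fun i j => dirDeriv b (e j) (g i)) = L * jacobianMatrix f * B := by
    ext1 i j
    simp only [L, B, Matrix.mul_apply, Matrix.of_apply, jacobianMatrix, dirDeriv_apply]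
    refine Finset.sum_congr rfl fun p _ => ?_
    rw [mul_comm, hc i, map_sum]
    simp [C_mul']
  rw [hmat]
  exact det_mul_mul_mem_minorsIdeal _ _ _ _

theorem minorsIdeal_le_pow (hf : ∀ i, f i = 0 ∨ ∃ d, 2 ≤ d ∧ (f i).IsHomogeneous d) (r : ℕ) :
    minorsIdeal r (jacobianMatrix f) ≤ irrelevantIdeal k n ^ r := by
  refine Ideal.span_le.2 ?_
  rintro _ ⟨a, e, rfl⟩
  refine det_mem_pow _ _ fun i j => ?_
  simp only [Matrix.submatrix_apply, jacobianMatrix, Matrix.of_apply]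
  obtain h | ⟨d, hd, h⟩ := hf (a i)
  · simp [h]
  · exact Ideal.pow_le_self (by omega) (mem_pow_of_isHomogeneous (h.pderiv (i := e j)))

theorem pow_le_quadricMinors (hn : 3 ≤ n)
    (b : Module.Basis (Fin (n + 1)) k (Fin (n + 1) → k)) :
    irrelevantIdeal k n ^ n ≤ quadricMinors (dirDeriv b) (dualForm b) Finset.univ n := by
  rw [irrelevantIdeal_eq_span_dualForm b, Ideal.span, Submodule.span_pow]
  refine Submodule.span_le.2 fun x hx => ?_
  obtain ⟨u, rfl⟩ := Set.mem_pow.1 hx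
  choose t ht using fun i => (u i).2
  simp only [← ht, List.prod_ofFn]
  exact prod_mem_quadricMinors (dirDeriv_dualForm b) hn (by simp) fun i => Finset.mem_univ _

end Jacobian

theorem proposition4p1 {k : Type*} [Field k] [IsAlgClosed k] (n : ℕ) (hn : 3 ≤ n)
    (Γ : Finset (ℙ k (Fin (n + 1) → k))) (hcard : Γ.card = n + 2)
    (hΓ : InGeneralLinearPosition Γ)
    {m : ℕ} (f : Fin m → MvPolynomial (Fin (n + 1)) k)
    (hf : ∀ i, ∃ d : ℕ, (f i).IsHomogeneous d)
    (hgen : Ideal.span (Set.range f) = idealOfPoints Γ) :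
    minorsIdeal n (jacobianMatrix f) = irrelevantIdeal k n ^ n ∧
    IsAluffiTorsionFree (idealOfPoints Γ)
      (idealOfPoints Γ ⊔ minorsIdeal n (jacobianMatrix f)) ∧
    ∀ t : ℕ, 1 ≤ t →
      idealOfPoints Γ ⊓ (idealOfPoints Γ ⊔ minorsIdeal n (jacobianMatrix f)) ^ t =
        idealOfPoints Γ * (idealOfPoints Γ ⊔ minorsIdeal n (jacobianMatrix f)) ^ (t - 1) := by
  obtain ⟨b, hb⟩ := exists_basis_of_generalPosition hcard hΓ
  have hf' := eq_zero_or_two_le_degree hb hf hgen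
  have hminors : minorsIdeal n (jacobianMatrix f) = irrelevantIdeal k n ^ n := by
    refine le_antisymm (minorsIdeal_le_pow hf' n)
      ((pow_le_quadricMinors hn b).trans (quadricMinors_le_minorsIdeal b n ?_))
    rintro _ ⟨i, -, j, -, l, -, p, -, hij, hlp, rfl⟩
    exact exists_linear_combination hf' (dualForm_quadric_isHomogeneous i j l p)
      (hgen ▸ dualForm_quadric_mem hb i j l p hij hlp)
  have hinf : ∀ t : ℕ, 1 ≤ t →
      idealOfPoints Γ ⊓ (idealOfPoints Γ ⊔ minorsIdeal n (jacobianMatrix f)) ^ t =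
        idealOfPoints Γ * (idealOfPoints Γ ⊔ minorsIdeal n (jacobianMatrix f)) ^ (t - 1) := by
    rw [hminors]
    exact fun t ht => inf_sup_pow_eq (inf_pow_le_mul_pow hn hb) (by omega) ht
  exact ⟨hminors, isAluffiTorsionFree_of_inf_pow_eq le_sup_left hinf, hinf⟩
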